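/- Let $\operatorname{ReLU}(x_1,\dots,x_d)=(\max\{0,x_1\},\dots,\max\{0,x_d\})$. For widths $n_0,\dots,n_{L+1}$ and $K\subset\mathbb R^{n_0}$, let $\mathcal H^{\mathrm{full}}_K(n_0,\dots,n_{L+1})$ be the set of restrictions to $K$ of all maps $f_{L+1}\circ\operatorname{ReLU}\circ f_L\circ\cdots\circ\operatorname{ReLU}\circ f_1$ with $f_l\colon\mathbb R^{n_{l-1}}\to\mathbb R^{n_l}$ affine. For $f\colon K\to\mathbb R^{m}$, call a connected set $D\subset K$ that is contained in the closure of its interior a connected region. A linear region of $f$ is a connected region $D$ on which $f$ is affine such that $f$ is not affine on any connected region $D'\subset K$ with $D\subsetneq D'$. Two linear regions $D,D'$ of $f$ (with the functions $f|_D,f|_{D'}$) are equivalent if there is a Euclidean transformation $\phi(x)=Ax+b$ ($A$ orthogonal) with $\phi(D)=D'$ and $f|_D=f|_{D'}\circ\phi|_D$. Let $c^\sim(f)$ be the number of equivalence classes of linear regions of $f$, and for a set $\mathcal H$ of functions let $c^\sim(\mathcal H)=\sup_{f\in\mathcal H}c^\sim(f)\in\mathbb N\cup\{\infty\}$. **Theorem.**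 Let $L\ge1$, $n=n_0\ge1$, $n_l\ge n$ for $1\le l\le L$, and $n_{L+1}\ge1$. If $L\ge2$, assume moreover that $n_L>n$. Then $$c^\sim\bigl(\mathcal H^{\mathrm{full}}_{[0,1]^n}(n_0,n_1,\dots,n_{L+1})\bigr)\;\ge\;\prod_{i=1}^{L-1}\left\lfloor\frac{n_i}{n}\right\rfloor^{n}\cdot\sum_{k=0}^{n}\binom{n_L}{k}.$$ -/

import Mathlib

noncomputable section

namespace ReLUComplexity

/-- Euclidean space `ℝ^d` with the Euclidean norm. -/
abbrev Euc (d : ℕ) : Type := EuclideanSpace ℝ (Fin d)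

/-- The coordinatewise rectifier `x ↦ (max 0 x₁, …, max 0 x_d)`. -/
def relu {d : ℕ} (x : Euc d) : Euc d := WithLp.toLp 2 fun i => max 0 (x i)

/-- The value of the `l`-th hidden layer: `ReLU ∘ f_l ∘ ⋯ ∘ ReLU ∘ f_1`. The widths are
`w 0, w 1, …`, and `f l : ℝ^(w l) → ℝ^(w (l + 1))` is the affine map number `l + 1`. -/
def hiddenLayer (w : ℕ → ℕ) (f : ∀ l, Euc (w l) →ᵃ[ℝ] Euc (w (l + 1))) :
    ∀ l, Euc (w 0) → Euc (w l)
  | 0 => fun x => x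
  | l + 1 => fun x => relu (f l (hiddenLayer w f l x))

/-- The network `f_{L+1} ∘ ReLU ∘ f_L ∘ ⋯ ∘ ReLU ∘ f_1` with `L` hidden layers. Only
`w 0, …, w (L + 1)` and the first `L + 1` affine maps matter. -/
def network (w : ℕ → ℕ) (L : ℕ) (f : ∀ l, Euc (w l) →ᵃ[ℝ] Euc (w (l + 1))) (x : Euc (w 0)) :
    Euc (w (L + 1)) :=
  f L (hiddenLayer w f L x)

/-- The set of restrictions to `K` of the fully connected ReLU networks of widths
`(w 0, w 1, …, w (L + 1))`. -/
def fullNetworks (w : ℕ → ℕ) (L : ℕ) (K : Set (Euc (w 0))) : Set (K → Euc (w (L + 1))) :=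
  {F | ∃ f : ∀ l, Euc (w l) →ᵃ[ℝ] Euc (w (l + 1)), F = fun x : K => network w L f (x : Euc (w 0))}

/-- The cube `[0,1]^d`. -/
def unitCube (d : ℕ) : Set (Euc d) := {x | ∀ i, x i ∈ Set.Icc (0 : ℝ) 1}

section Complexity

variable {d e : ℕ} {K : Set (Euc d)}

/-- A connected region in `K`: a (nonempty) connected subset of `K` without lower-dimensional
parts, i.e. contained in the closure of its interior. -/
def IsRegion (K D : Set (Euc d)) : Prop :=
  D ⊆ K ∧ IsConnected D ∧ D ⊆ closure (interior D)

/-- `f` is linear (that is, affine) on `D`. -/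
def IsLinearOn (f : K → Euc e) (D : Set (Euc d)) : Prop :=
  ∃ g : Euc d →ᵃ[ℝ] Euc e, ∀ x : K, (x : Euc d) ∈ D → f x = g x

/-- A linear region of `f`: a connected region on which `f` is linear, and which is not
strictly contained in another such region. -/
def IsLinearRegion (f : K → Euc e) (D : Set (Euc d)) : Prop :=
  IsRegion K D ∧ IsLinearOn f D ∧
    ∀ D' : Set (Euc d), IsRegion K D' → D ⊂ D' → ¬ IsLinearOn f D'

/-- The set of linear functions of `f`, each pair `(f|_D, D)` being recorded by `D`. -/
abbrev LinearFunctions (f : K → Euc e) : Type := {D : Set (Euc d) // IsLinearRegion f D}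

/-- `(f|_D, D) ∼ (f|_D', D')`: there is a Euclidean transformation `φ` of `ℝ^d` with
`φ(D) = D'` and `f|_D = f|_D' ∘ φ|_D`. -/
def Equivalent (f : K → Euc e) (D D' : LinearFunctions f) : Prop :=
  ∃ φ : Euc d ≃ᵃⁱ[ℝ] Euc d, φ '' D.1 = D'.1 ∧
    ∀ x y : K, (x : Euc d) ∈ D.1 → φ x = y → f x = f y

theorem equivalent_equivalence (f : K → Euc e) : Equivalence (Equivalent f) where
  refl D := ⟨AffineIsometryEquiv.refl ℝ (Euc d), by simp, fun x y _ h => by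
    have : x = y := Subtype.ext (by simpa using h)
    rw [this]⟩
  symm := by
    rintro D D' ⟨φ, hφ, hf⟩
    refine ⟨φ.symm, ?_, fun x y hx hxy => ?_⟩
    · rw [← hφ, Set.image_image]; simp
    · have h1 : φ y = x := by rw [← hxy]; simp
      have h2 : (y : Euc d) ∈ D.1 := by
        rw [← hφ] at hx
        obtain ⟨z, hz, hzx⟩ := hx
        rw [← h1] at hzx
        rwa [← φ.injective hzx]
      exact (hf y x h2 h1).symm
  trans := by
    rintro D D' D'' ⟨φ, hφ, hf⟩ ⟨ψ, hψ, hg⟩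
    refine ⟨φ.trans ψ, ?_, fun x y hx hxy => ?_⟩
    · rw [← hψ, ← hφ, Set.image_image]; simp
    · have h1 : φ x ∈ D'.1 := hφ ▸ Set.mem_image_of_mem _ hx
      rw [hf x ⟨φ x, D'.2.1.1 h1⟩ hx rfl]
      exact hg _ y h1 (by simpa using hxy)

/-- The equivalence relation `∼` on the set of linear functions of `f`. -/
def linearSetoid (f : K → Euc e) : Setoid (LinearFunctions f) :=
  ⟨Equivalent f, equivalent_equivalence f⟩

/-- `c^∼(f)`: the number of equivalence classes of linear functions of `f`. -/
def complexity (f : K → Euc e) : ℕ∞ := ENat.card (Quotient (linearSetoid f))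

/-- `c^∼(H)`: the largest value of `c^∼(f)`, `f ∈ H` (as a supremum in `ℕ ∪ {∞}`). -/
def classComplexity (H : Set (K → Euc e)) : ℕ∞ := ⨆ f ∈ H, complexity f

end Complexity

end ReLUComplexity

end

open Set Filter Topology

namespace ReLUComplexity

/-! A Euclidean transformation that matches two affine pieces carries one gradient to the other, so
the gradient norm is an invariant of the class of a linear region. It therefore suffices to build a
scalar network whose gradients have many distinct norms and to copy it into every output coordinate
(`card_le_complexity`). The last hidden layer is an arrangement of `n_L` hyperplanes realising `∑ k
≤ n, n_L.choose k` activation patterns inside the cube. Generic output weights separate the norms of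
the corresponding gradients (`exists_lastLayer`). Each earlier layer applies to every coordinate a
zigzag with `p = ⌊n_i / n⌋` pieces, folding `p ^ n` boxes onto the cube. A gradient `v` becomes one
rescaled copy of `v` per box, and generic slopes keep all norms distinct (`exists_fold`). This needs
`v` to have no zero coordinate, which is where `n_L > n` enters: it excludes the empty activation
pattern. -/

/-! ### Gradient norms as invariants of linear regions. -/

/-- `F` agrees with an affine function of gradient `v` near some point of the open unit cube. -/
def HasPiece {n : ℕ} (F : Euc n → ℝ) (v : Euc n) : Prop :=
  ∃ x : Euc n, (∀ i, x i ∈ Ioo (0 : ℝ) 1) ∧ ∃ c : ℝ, ∀ᶠ y in 𝓝 x, F y = inner ℝ v y + c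

/-- Every open connected set on which `f` is affine extends to a linear region. -/
theorem exists_isLinearRegion_superset {d e : ℕ} {K : Set (Euc d)} (f : K → Euc e)
    {U : Set (Euc d)} (hUo : IsOpen U) (hUc : IsConnected U) (hUK : U ⊆ K)
    (hU : IsLinearOn f U) : ∃ D, IsLinearRegion f D ∧ U ⊆ D := by
  obtain ⟨g, hg⟩ := hU
  have key : ∀ D, U ⊆ D → IsLinearOn f D → ∀ x : K, (x : Euc d) ∈ D → f x = g x := by
    rintro D hUD ⟨g', hg'⟩ x hx
    have : g' = g := AffineMap.ext_on (hUo.affineSpan_eq_top hUc.nonempty) fun y hy => by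
      rw [← hg' ⟨y, hUK hy⟩ (hUD hy), ← hg ⟨y, hUK hy⟩ hy]
    rw [hg' x hx, this]
  -- By `key` all members of `S` carry the same `g`, so their union is again an affine region, and
  -- it is maximal.
  let S : Set (Set (Euc d)) := {D | IsRegion K D ∧ IsLinearOn f D ∧ U ⊆ D}
  have hUS : U ∈ S :=
    ⟨⟨hUK, hUc, by rw [hUo.interior_eq]; exact subset_closure⟩, ⟨g, hg⟩, Subset.rfl⟩
  have hUD : U ⊆ ⋃₀ S := subset_sUnion_of_mem hUS
  obtain ⟨u, hu⟩ := hUc.nonempty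
  refine ⟨⋃₀ S, ⟨⟨sUnion_subset fun D hD => hD.1.1, ⟨⟨u, hUD hu⟩, ?_⟩, ?_⟩, ⟨g, ?_⟩, ?_⟩, hUD⟩
  · exact isPreconnected_sUnion u S (fun D hD => hD.2.2 hu) fun D hD => hD.1.2.1.isPreconnected
  · exact sUnion_subset fun D hD => hD.1.2.2.trans
      (closure_mono (interior_mono (subset_sUnion_of_mem hD)))
  · rintro x ⟨D, hD, hx⟩
    exact key D hD.2.2 hD.2.1 x hx
  · intro D' hD' hss hlin
    exact hss.2 (subset_sUnion_of_mem ⟨hD', hlin, hUD.trans hss.1⟩)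

/-- The number of gradients with pairwise distinct norms is a lower bound for the complexity. -/
theorem card_le_complexity {d e : ℕ} (he : 1 ≤ e) {ι : Type} [Fintype ι] (F : Euc d → ℝ)
    (f : unitCube d → Euc e) (hf : ∀ x, f x = WithLp.toLp 2 fun _ => F x)
    (v : ι → Euc d) (hv : ∀ k, HasPiece F (v k)) (hinj : Function.Injective fun k => ‖v k‖) :
    (Fintype.card ι : ℕ∞) ≤ complexity f := by
  have hreg : ∀ k, ∃ D : LinearFunctions f, ∃ U ⊆ D.1, IsOpen U ∧ U.Nonempty ∧
      ∃ c : ℝ, ∀ y ∈ U, F y = inner ℝ (v k) y + c := by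
    intro k
    obtain ⟨x, hx, c, hc⟩ := hv k
    have hcube : ∀ᶠ y in 𝓝 x, y ∈ unitCube d := by
      have : ∀ᶠ y in 𝓝 x, ∀ i, y i ∈ Ioo (0 : ℝ) 1 := by
        refine eventually_all.2 fun i => ?_
        have hcont : ContinuousAt (fun y : Euc d => y i) x := by fun_prop
        exact hcont.eventually (Ioo_mem_nhds (hx i).1 (hx i).2)
      filter_upwards [this] with y hy i using Ioo_subset_Icc_self (hy i)
    obtain ⟨r, hr, hball⟩ := Metric.eventually_nhds_iff_ball.1 (hc.and hcube)
    obtain ⟨D, hD, hsub⟩ := exists_isLinearRegion_superset f (U := Metric.ball x r)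
      Metric.isOpen_ball ((convex_ball x r).isConnected ⟨x, Metric.mem_ball_self hr⟩)
      (fun y hy => (hball y hy).2) (by
        let l : Euc d →ₗ[ℝ] Euc e :=
          ((WithLp.linearEquiv 2 ℝ (Fin e → ℝ)).symm : (Fin e → ℝ) →ₗ[ℝ] Euc e) ∘ₗ
            LinearMap.pi fun _ => (innerSL ℝ (v k)).toLinearMap
        refine ⟨l.toAffineMap + AffineMap.const ℝ _ (WithLp.toLp 2 fun _ => c), fun y hy => ?_⟩
        rw [hf, (hball y hy).1]
        ext i
        simp [l])
    exact ⟨⟨D, hD⟩, _, hsub, Metric.isOpen_ball, ⟨x, Metric.mem_ball_self hr⟩, c,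
      fun y hy => (hball y hy).1⟩
  choose D U hUD hUo hUne c hc using hreg
  have hinj' : Function.Injective fun k => Quotient.mk (linearSetoid f) (D k) := by
    intro k k' hkk
    obtain ⟨φ, hφ, hφf⟩ := (Quotient.exact hkk : Equivalent f (D k) (D k'))
    apply hinj
    let a : ι → Euc d →ᵃ[ℝ] ℝ := fun k =>
      (innerSL ℝ (v k)).toLinearMap.toAffineMap + AffineMap.const ℝ _ (c k)
    have ha : ∀ k y, a k y = inner ℝ (v k) y + c k := fun k y => by simp [a]
    have hDa : ∀ y ∈ (D k').1, F y = a k' y := by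
      intro y hy
      obtain ⟨g, hg⟩ := (D k').2.2.1
      let pr : Euc e →ₗ[ℝ] ℝ := (EuclideanSpace.proj (𝕜 := ℝ) (⟨0, he⟩ : Fin e)).toLinearMap
      have hF : ∀ z ∈ (D k').1, F z = (pr.toAffineMap.comp g) z := by
        intro z hz
        have h1 := hg ⟨z, (D k').2.1.1 hz⟩ hz
        rw [hf] at h1
        simp [pr, ← h1]
      rw [hF y hy]
      congr 1
      refine AffineMap.ext_on ((hUo k').affineSpan_eq_top (hUne k')) fun z hz => ?_
      rw [← hF z (hUD k' hz), ha, hc k' z hz]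
    -- Both sides compute `F` on the open set `U k`, which determines an affine map; the linear
    -- parts then relate the gradients by an isometry.
    have heq : a k = (a k').comp φ.toAffineEquiv.toAffineMap := by
      refine AffineMap.ext_on ((hUo k).affineSpan_eq_top (hUne k)) fun z hz => ?_
      have hz' := hUD k hz
      have hφz : φ z ∈ (D k').1 := hφ ▸ mem_image_of_mem _ hz'
      have h1 := hφf ⟨z, (D k).2.1.1 hz'⟩ ⟨φ z, (D k').2.1.1 hφz⟩ hz' rfl
      rw [hf, hf] at h1
      have h2 : F z = F (φ z) := congrArg (fun u : Euc e => u ⟨0, he⟩) h1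
      rw [ha, ← hc k z hz, h2, hDa _ hφz]
      rfl
    have hlin : ∀ y, inner ℝ (v k) y = inner ℝ (v k') (φ.linearIsometryEquiv y) := by
      intro y
      have h1 := congrArg (fun g : Euc d →ᵃ[ℝ] ℝ => g.linear y) heq
      simpa [a] using h1
    have hvk : v k = φ.linearIsometryEquiv.symm (v k') := by
      refine ext_inner_right ℝ fun y => ?_
      rw [hlin, ← φ.linearIsometryEquiv.symm.inner_map_map]
      simp
    simp [hvk]
  have h := ENat.card_le_card_of_injective hinj'
  simpa [complexity] using h

/-! ### Generic parameters. -/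

/-- Finitely many non-identically vanishing polynomials have a common non-zero in any box with
infinite sides. -/
theorem exists_forall_eval_ne_zero {σ κ : Type*} [Finite κ] (P : κ → MvPolynomial σ ℝ)
    (hP : ∀ k, ∃ x, MvPolynomial.eval x (P k) ≠ 0) (s : σ → Set ℝ) (hs : ∀ i, (s i).Infinite) :
    ∃ x : σ → ℝ, (∀ i, x i ∈ s i) ∧ ∀ k, MvPolynomial.eval x (P k) ≠ 0 := by
  have := Fintype.ofFinite κ
  by_contra! h
  -- The polynomial ring is a domain, so a vanishing product has a vanishing factor.
  have h0 : ∏ k, P k = 0 := by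
    refine MvPolynomial.funext_set s hs fun x hx => ?_
    obtain ⟨k, hk⟩ := h x fun i => hx i (mem_univ i)
    rw [map_prod, map_zero]
    exact Finset.prod_eq_zero (Finset.mem_univ k) hk
  obtain ⟨k, -, hk⟩ := Finset.prod_eq_zero_iff.1 h0
  obtain ⟨x, hx⟩ := hP k
  simp [hk] at hx

/-- The affine map `x ↦ a x + b`. -/
noncomputable def affineOf {m n : ℕ} (a : Fin m → Fin n → ℝ) (b : Fin m → ℝ) : Euc n →ᵃ[ℝ] Euc m :=
  (Matrix.toEuclideanLin (Matrix.of a)).toAffineMap + AffineMap.const ℝ _ (WithLp.toLp 2 b)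

@[simp] theorem affineOf_apply {m n : ℕ} (a : Fin m → Fin n → ℝ) (b : Fin m → ℝ) (x : Euc n)
    (i : Fin m) : affineOf a b x i = ∑ j, a i j * x j + b i := by
  simp [affineOf, Matrix.mulVec, dotProduct]

theorem inner_eq_sum {n : ℕ} (v x : Euc n) : inner ℝ v x = ∑ i, v i * x i := by
  simp [PiLp.inner_apply, mul_comm]

/-! ### One-dimensional zigzags. -/

/-- The start of the `j`-th piece of the zigzag with slopes `s 0, -s 1, s 2, …` and values
in `[0,1]`. -/
noncomputable def breakpoint (s : ℕ → ℝ) (j : ℕ) : ℝ := ∑ k ∈ Finset.range j, (s k)⁻¹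

/-- The changes of slope of the zigzag with slopes `s 0, -s 1, s 2, …`. -/
noncomputable def zigzagCoeff (s : ℕ → ℝ) : ℕ → ℝ
  | 0 => s 0
  | j + 1 => (-1) ^ (j + 1) * (s (j + 1) + s j)

/-- The zigzag with `p` pieces as a combination of `p` rectifiers. -/
noncomputable def zigzag (s : ℕ → ℝ) (p : ℕ) (x : ℝ) : ℝ :=
  ∑ k ∈ Finset.range p, zigzagCoeff s k * max 0 (x - breakpoint s k)

/-- On piece `j` exactly the rectifiers `0, …, j` are active. The constant is the height at the
breakpoint: `0` for even `j`, `1` for odd `j`. -/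
theorem sum_zigzagCoeff_mul {s : ℕ → ℝ} (hs : ∀ j, 0 < s j) (x : ℝ) (j : ℕ) :
    ∑ k ∈ Finset.range (j + 1), zigzagCoeff s k * (x - breakpoint s k) =
      (-1) ^ j * s j * (x - breakpoint s j) + (1 - (-1) ^ j) / 2 := by
  induction j with
  | zero => simp [zigzagCoeff, breakpoint]
  | succ j ih =>
    have hb : breakpoint s j = breakpoint s (j + 1) - (s j)⁻¹ := by
      simp [breakpoint, Finset.sum_range_succ]
    rw [Finset.sum_range_succ, ih, hb, zigzagCoeff]
    have := (hs j).ne'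
    field_simp
    ring

theorem breakpoint_mono {s : ℕ → ℝ} (hs : ∀ j, 0 < s j) : Monotone (breakpoint s) :=
  monotone_nat_of_le_succ fun j => by
    simpa [breakpoint, Finset.sum_range_succ] using (hs j).le

theorem zigzag_eq {s : ℕ → ℝ} (hs : ∀ j, 0 < s j) {p j : ℕ} (hj : j < p) {x : ℝ}
    (hx : x ∈ Ioo (breakpoint s j) (breakpoint s (j + 1))) :
    zigzag s p x = (-1) ^ j * s j * (x - breakpoint s j) + (1 - (-1) ^ j) / 2 := by
  rw [← sum_zigzagCoeff_mul hs, zigzag]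
  symm
  rw [← Finset.sum_subset (Finset.range_mono (Nat.succ_le_of_lt hj))]
  · refine Finset.sum_congr rfl fun k hk => ?_
    have := breakpoint_mono hs (Nat.lt_succ_iff.1 (Finset.mem_range.1 hk))
    rw [max_eq_right (by linarith [hx.1])]
  · intro k _ hk
    have := breakpoint_mono hs (not_lt.1 fun h => hk (Finset.mem_range.2 h))
    rw [max_eq_left (by linarith [hx.2]), mul_zero]

/-- Each of the `p` pieces of the zigzag attains every value in `(0,1)`, in the unit interval. -/
theorem exists_zigzag_piece {p : ℕ} {s : ℕ → ℝ} (hs : ∀ j, (p : ℝ) ≤ s j) {j : ℕ} (hj : j < p)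
    {y : ℝ} (hy : y ∈ Ioo (0 : ℝ) 1) :
    ∃ x ∈ Ioo (0 : ℝ) 1, ∃ b, (∀ᶠ z in 𝓝 x, zigzag s p z = (-1) ^ j * s j * z + b) ∧
      (-1) ^ j * s j * x + b = y := by
  have hp : (0 : ℝ) < p := by exact_mod_cast (Nat.zero_le j).trans_lt hj
  have hs0 : ∀ j, 0 < s j := fun j => hp.trans_le (hs j)
  have hb0 : 0 ≤ breakpoint s j := Finset.sum_nonneg fun k _ => (inv_pos.2 (hs0 k)).le
  -- Slopes at least `p` give pieces of length at most `1 / p`, so all `p` of them fit into the unit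
  -- interval.
  have hb1 : breakpoint s (j + 1) ≤ 1 := calc
    breakpoint s (j + 1) ≤ breakpoint s p := breakpoint_mono hs0 hj
    _ ≤ ∑ k ∈ Finset.range p, (p : ℝ)⁻¹ :=
      Finset.sum_le_sum fun k _ => inv_anti₀ hp (hs k)
    _ = 1 := by simp [hp.ne']
  have hsucc : breakpoint s (j + 1) = breakpoint s j + (s j)⁻¹ := by
    simp [breakpoint, Finset.sum_range_succ]
  obtain ⟨u, hu, hxu⟩ : ∃ u ∈ Ioo (0 : ℝ) 1, (-1) ^ j * u + (1 - (-1) ^ j) / 2 = y := by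
    rcases neg_one_pow_eq_or ℝ j with h | h
    · exact ⟨y, hy, by rw [h]; ring⟩
    · exact ⟨1 - y, ⟨by linarith [hy.2], by linarith [hy.1]⟩, by rw [h]; ring⟩
  have hsj := inv_pos.2 (hs0 j)
  have hmem : breakpoint s j + u * (s j)⁻¹ ∈ Ioo (breakpoint s j) (breakpoint s (j + 1)) := by
    constructor
    · nlinarith [hu.1]
    · nlinarith [hu.2]
  refine ⟨_, ⟨hb0.trans_lt hmem.1, hmem.2.trans_le hb1⟩,
    -((-1) ^ j * s j * breakpoint s j) + (1 - (-1) ^ j) / 2, ?_, ?_⟩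
  · filter_upwards [Ioo_mem_nhds hmem.1 hmem.2] with z hz
    rw [zigzag_eq hs0 hj hz]
    ring
  · rw [← hxu]
    have := (hs0 j).ne'
    field_simp
    ring

/-! ### Folding layers. -/

/-- Generic slopes keep the norms of all rescaled gradients distinct. -/
theorem exists_slopes {n p : ℕ} {ι : Type} [Finite ι] (v : ι → Euc n) (hv0 : ∀ k i, v k i ≠ 0)
    (hinj : Function.Injective fun k => ‖v k‖) :
    ∃ s : Fin n × Fin p → ℝ, (∀ q, (p : ℝ) ≤ s q) ∧
      Function.Injective fun q : ι × (Fin n → Fin p) =>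
        ∑ i, (s (i, q.2 i) * v q.1 i) ^ 2 := by
  let N : ι × (Fin n → Fin p) → MvPolynomial (Fin n × Fin p) ℝ := fun q =>
    ∑ i, (MvPolynomial.X (i, q.2 i) * MvPolynomial.C (v q.1 i)) ^ 2
  have hN : ∀ q s, MvPolynomial.eval s (N q) = ∑ i, (s (i, q.2 i) * v q.1 i) ^ 2 := by
    intro q s
    simp [N]
  obtain ⟨s, hs, hsN⟩ := exists_forall_eval_ne_zero
    (fun q : {q : (ι × (Fin n → Fin p)) × (ι × (Fin n → Fin p)) // q.1 ≠ q.2} =>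
      N q.1.1 - N q.1.2) (by
      rintro ⟨⟨⟨k, σ⟩, ⟨k', σ'⟩⟩, hne⟩
      by_cases hσ : σ = σ'
      · subst hσ
        refine ⟨fun _ => 1, ?_⟩
        have hk : k ≠ k' := fun h => hne (by rw [h])
        simp only [map_sub, hN, one_mul, ← EuclideanSpace.real_norm_sq_eq]
        rw [sub_ne_zero]
        intro h
        exact hk (hinj ((sq_eq_sq₀ (norm_nonneg _) (norm_nonneg _)).1 h))
      · obtain ⟨i, hi⟩ := Function.ne_iff.1 hσ
        -- Only the slope `(i, σ i)` survives, and `σ'` does not use it: the values are `v k i ^ 2 ≠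
        -- 0` and `0`.
        refine ⟨Pi.single (i, σ i) 1, ?_⟩
        simp only [map_sub, hN]
        rw [Finset.sum_eq_single i, Finset.sum_eq_zero]
        · simpa using hv0 k i
        · intro l _
          rw [Pi.single_eq_of_ne]
          · simp
          · rintro h
            obtain ⟨rfl, h2⟩ := Prod.mk.inj h
            exact hi h2.symm
        · intro l _ hl
          rw [Pi.single_eq_of_ne]
          · simp
          · exact fun h => hl (Prod.mk.inj h).1
        · simp)
    (fun _ => Ici (p : ℝ)) fun _ => Ici_infinite _
  refine ⟨s, hs, fun q q' hqq => ?_⟩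
  by_contra hne
  refine hsN ⟨(q, q'), hne⟩ ?_
  simp only [map_sub, hN]
  exact sub_eq_zero.2 hqq

/-- Precomposition with a suitable folding layer of width `m` multiplies the number of gradients
of distinct norms by `⌊m / n⌋ ^ n`. -/
theorem exists_fold {n m : ℕ} (hn : 1 ≤ n) (hm : n ≤ m) {ι : Type} [Finite ι]
    (F : Euc n → ℝ) (v : ι → Euc n) (hv : ∀ k, HasPiece F (v k)) (hv0 : ∀ k i, v k i ≠ 0)
    (hinj : Function.Injective fun k => ‖v k‖) :
    ∃ (B : Euc n →ᵃ[ℝ] Euc m) (A : Euc m →ᵃ[ℝ] Euc n)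
      (v' : ι × (Fin n → Fin (m / n)) → Euc n),
      (∀ q, HasPiece (fun x => F (A (relu (B x)))) (v' q)) ∧ (∀ q i, v' q i ≠ 0) ∧
      Function.Injective fun q => ‖v' q‖ := by
  have hp : 0 < m / n := Nat.div_pos hm hn
  have hnp : n * (m / n) ≤ m := Nat.mul_div_le m n
  generalize m / n = p at hp hnp ⊢
  obtain ⟨s, hs, hsinj⟩ := exists_slopes (p := p) v hv0 hinj
  let S : Fin n → ℕ → ℝ := fun i j => if h : j < p then s (i, ⟨j, h⟩) else p
  have hS : ∀ i j, (p : ℝ) ≤ S i j := by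
    intro i j
    simp only [S]
    split_ifs
    exacts [hs _, le_rfl]
  have hSs : ∀ i (j : Fin p), S i j = s (i, j) := fun i j => by simp [S]
  let e : Fin n × Fin p → Fin m := fun q => Fin.castLE hnp (finProdFinEquiv q)
  have he : Function.Injective e :=
    (Fin.castLE_injective _).comp finProdFinEquiv.injective
  have : Nonempty (Fin n × Fin p) := ⟨(⟨0, hn⟩, ⟨0, hp⟩)⟩
  let g := Function.invFun e
  have hg : ∀ q, g (e q) = q := Function.leftInverse_invFun he
  let B : Euc n →ᵃ[ℝ] Euc m :=
    affineOf (fun l => Pi.single (g l).1 1) fun l => -breakpoint (S (g l).1) (g l).2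
  -- Neurons outside the range of `e` get weight `0`, so their arbitrary values under `g` are
  -- harmless.
  let A : Euc m →ᵃ[ℝ] Euc n :=
    affineOf (fun i l => ∑ j : Fin p, if l = e (i, j) then zigzagCoeff (S i) j else 0) 0
  have hBx : ∀ x q, B x (e q) = x q.1 - breakpoint (S q.1) q.2 := by
    intro x q
    simp [B, hg, Pi.single_apply, sub_eq_add_neg]
  have hfold : ∀ x i, A (relu (B x)) i = zigzag (S i) p (x i) := by
    intro x i
    rw [zigzag, ← Fin.sum_univ_eq_sum_range
      (fun k => zigzagCoeff (S i) k * max 0 (x i - breakpoint (S i) k)) p]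
    simp only [A, affineOf_apply, Finset.sum_mul, Pi.zero_apply, add_zero]
    rw [Finset.sum_comm]
    refine Finset.sum_congr rfl fun j _ => ?_
    simp [relu, hBx]
  have hcontA : Continuous A := A.continuous_of_finiteDimensional
  have hcontB : Continuous B := B.continuous_of_finiteDimensional
  have hcontR : Continuous (relu : Euc m → Euc m) := by
    unfold relu
    fun_prop
  refine ⟨B, A, fun q => WithLp.toLp 2 fun i =>
    (-1) ^ (q.2 i : ℕ) * s (i, q.2 i) * v q.1 i, ?_, ?_, ?_⟩
  · rintro ⟨k, σ⟩
    obtain ⟨y, hy, c, hc⟩ := hv k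
    -- `x` is the point of the box `σ` that the fold sends to `y`.
    choose x hx b hb hby using fun i => exists_zigzag_piece (hS i) (σ i).2 (hy i)
    have hAy : A (relu (B (WithLp.toLp 2 x))) = y := by
      ext i
      rw [hfold, ← hby i]
      exact (hb i).self_of_nhds
    refine ⟨WithLp.toLp 2 x, hx, ∑ i, v k i * b i + c, ?_⟩
    have h1 : ∀ᶠ z in 𝓝 (WithLp.toLp 2 x : Euc n), F (A (relu (B z))) =
        inner ℝ (v k) (A (relu (B z))) + c := by
      have hcont : ContinuousAt (fun z => A (relu (B z))) (WithLp.toLp 2 x : Euc n) :=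
        (hcontA.comp (hcontR.comp hcontB)).continuousAt
      exact hcont.tendsto.eventually (by rwa [← hAy] at hc)
    have h2 : ∀ᶠ z in 𝓝 (WithLp.toLp 2 x : Euc n), ∀ i,
        zigzag (S i) p (z i) = (-1) ^ (σ i : ℕ) * S i (σ i) * z i + b i := by
      refine eventually_all.2 fun i => ?_
      have hcont : ContinuousAt (fun z : Euc n => z i) (WithLp.toLp 2 x) := by fun_prop
      exact hcont.eventually (hb i)
    filter_upwards [h1, h2] with z hz1 hz2
    rw [hz1, inner_eq_sum, inner_eq_sum, ← add_assoc, ← Finset.sum_add_distrib]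
    congr 1
    refine Finset.sum_congr rfl fun i _ => ?_
    rw [hfold, hz2, hSs]
    ring
  · rintro ⟨k, σ⟩ i
    have h1 : s (i, σ i) ≠ 0 := ((Nat.cast_pos.2 hp).trans_le (hs _)).ne'
    simpa [h1] using hv0 k i
  · intro q q' hqq
    apply hsinj
    have h := congrArg (· ^ 2) hqq
    simpa [EuclideanSpace.real_norm_sq_eq, mul_pow, ← pow_mul, mul_comm _ 2] using h

/-! ### Hyperplane arrangement from the moment curve. -/

/-- The sign at `2 j + 2` of a polynomial that is positive at infinity and whose positive roots
are simple and given by `2 g + 3`, `g ∈ T`. -/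
def rootSign {m : ℕ} (T : Finset (Fin m)) (j : ℕ) : ℝ := ∏ g ∈ T, if j ≤ g then -1 else 1

theorem rootSign_eq_or {m : ℕ} (T : Finset (Fin m)) (j : ℕ) :
    rootSign T j = 1 ∨ rootSign T j = -1 := by
  rw [← sq_eq_one_iff, rootSign, ← Finset.prod_pow]
  refine Finset.prod_eq_one fun g _ => ?_
  split_ifs <;> norm_num

/-- Between `2 j + 2` and `2 j + 4` the only possible root is `2 j + 3`, so the sign changes exactly
when `j ∈ T`. -/
theorem rootSign_eq_succ_mul {m : ℕ} (T : Finset (Fin m)) (j : Fin m) :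
    rootSign T j = rootSign T (j + 1) * if j ∈ T then -1 else 1 := by
  rw [← Finset.prod_ite_eq T j fun _ => (-1 : ℝ), rootSign, rootSign, ← Finset.prod_mul_distrib]
  refine Finset.prod_congr rfl fun g _ => ?_
  rcases lt_trichotomy j g with h | rfl | h
  · have h1 : (j : ℕ) < g := h
    simp [h1.le, h1, h.ne]
  · simp
  · have h1 : (g : ℕ) < j := h
    have h2 : ¬ (j : ℕ) + 1 ≤ g := by omega
    simp [h, h2, h.ne']

theorem rootSign_injective {m : ℕ} {T T' : Finset (Fin m)}
    (h : ∀ j : Fin m, rootSign T j = rootSign T' j) : T = T' := by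
  -- The index `m`, successor of the last neuron, is needed too; past all roots the sign is `1`.
  have h' : ∀ j : ℕ, rootSign T j = rootSign T' j := by
    intro j
    rcases lt_or_ge j m with hj | hj
    · exact h ⟨j, hj⟩
    · have : ∀ T : Finset (Fin m), rootSign T j = 1 := fun T =>
        Finset.prod_eq_one fun g _ => if_neg (by omega)
      rw [this, this]
  ext j
  have h1 := h' j
  rw [rootSign_eq_succ_mul, rootSign_eq_succ_mul, h'] at h1
  by_cases hT : j ∈ T <;> by_cases hT' : j ∈ T' <;>
    rcases rootSign_eq_or T' (j + 1) with h2 | h2 <;> simp [hT, hT', h2] at h1 ⊢ <;> norm_num at h1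

/-- The monic polynomial with roots `2 g + 3`, `g ∈ T`, and a root of order `n - #T` at `-1`. -/
noncomputable def rootPoly {m : ℕ} (n : ℕ) (T : Finset (Fin m)) : Polynomial ℝ :=
  (∏ g ∈ T, (Polynomial.X - Polynomial.C (2 * (g : ℝ) + 3))) *
    (Polynomial.X + Polynomial.C 1) ^ (n - T.card)

theorem rootPoly_eval {m n : ℕ} {T : Finset (Fin m)} (hT : T.card ≤ n) (s : ℝ) :
    (rootPoly n T).eval s = ∑ i : Fin n, (rootPoly n T).coeff i * s ^ (i : ℕ) + s ^ n := by
  have hm1 : (∏ g ∈ T, (Polynomial.X - Polynomial.C (2 * (g : ℝ) + 3))).Monic :=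
    Polynomial.monic_prod_of_monic _ _ fun g _ => Polynomial.monic_X_sub_C _
  have hm2 : ((Polynomial.X + Polynomial.C (1 : ℝ)) ^ (n - T.card)).Monic :=
    (Polynomial.monic_X_add_C _).pow _
  have hdeg : (rootPoly n T).natDegree = n := by
    rw [rootPoly, hm1.natDegree_mul hm2, Polynomial.natDegree_prod_of_monic _ _
      fun g _ => Polynomial.monic_X_sub_C _, (Polynomial.monic_X_add_C _).natDegree_pow]
    simp only [Polynomial.natDegree_X_sub_C, Polynomial.natDegree_X_add_C]
    simp [hT]
  have hmon : (rootPoly n T).coeff n = 1 := by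
    have h : (rootPoly n T).Monic := hm1.mul hm2
    simpa only [hdeg] using h.coeff_natDegree
  rw [Polynomial.eval_eq_sum_range, hdeg, Finset.sum_range_succ, hmon, one_mul,
    ← Fin.sum_univ_eq_sum_range (fun i => (rootPoly n T).coeff i * s ^ i)]

theorem rootSign_mul_rootPoly_pos {m : ℕ} (n : ℕ) (T : Finset (Fin m)) (j : ℕ) :
    0 < rootSign T j * (rootPoly n T).eval (2 * (j : ℝ) + 2) := by
  rw [rootPoly, Polynomial.eval_mul, ← mul_assoc, Polynomial.eval_prod, rootSign,
    ← Finset.prod_mul_distrib]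
  refine mul_pos (Finset.prod_pos fun g _ => ?_) ?_
  · split_ifs with h
    · have : (j : ℝ) ≤ g := by exact_mod_cast h
      simp
      linarith
    · have : (g : ℝ) + 1 ≤ j := by exact_mod_cast not_le.1 h
      simp
      linarith
  · simp only [Polynomial.eval_pow, Polynomial.eval_add, Polynomial.eval_X, Polynomial.eval_C]
    positivity

/-- An arrangement of `m` oriented hyperplanes in general position in the unit cube: the sets of
at most `n` indices are mapped injectively to sign patterns that are attained. -/
theorem exists_arrangement (n m : ℕ) :
    ∃ (b : Fin m → Fin n → ℝ) (c : Fin m → ℝ) (y : Finset (Fin m) → Euc n)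
      (S : Finset (Fin m) → Finset (Fin m)),
      (∀ j i, b j i ≠ 0) ∧ Function.Injective S ∧ S Finset.univ = ∅ ∧
      (∀ T i, y T i ∈ Ioo (0 : ℝ) 1) ∧
      ∀ T, T.card ≤ n → ∀ j, (j ∈ S T → 0 < ∑ i, b j i * y T i + c j) ∧
        (j ∉ S T → ∑ i, b j i * y T i + c j < 0) := by
  let U : Finset (Fin m) := Finset.univ
  let R : ℝ := 1 + ∑ T : Finset (Fin m), ∑ i : Fin n, |(rootPoly n T).coeff i|
  have hR : ∀ (T : Finset (Fin m)) (i : Fin n), |(rootPoly n T).coeff i| < R := by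
    intro T i
    have h1 := Finset.single_le_sum (f := fun i : Fin n => |(rootPoly n T).coeff i|)
      (fun i _ => abs_nonneg _) (Finset.mem_univ i)
    have h2 := Finset.single_le_sum
      (f := fun T : Finset (Fin m) => ∑ i : Fin n, |(rootPoly n T).coeff i|)
      (fun T _ => Finset.sum_nonneg fun i _ => abs_nonneg _) (Finset.mem_univ T)
    simp only [R]
    linarith
  have hR0 : 0 < R := add_pos_of_pos_of_nonneg one_pos
    (Finset.sum_nonneg fun T _ => Finset.sum_nonneg fun i _ => abs_nonneg _)
  have hU : ∀ j, rootSign U j ≠ 0 := fun j => by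
    rcases rootSign_eq_or U j with h | h <;> rw [h] <;> norm_num
  -- A point of the cube encodes the lower coefficients of a monic polynomial of degree `n`,
  -- rescaled by `R` from `(-R, R)` to `(0, 1)`. Hyperplane `j` tests the sign at `2 j + 2`, a
  -- nonzero node so that no weight vanishes. The factor `-rootSign U j` orients it so that the full
  -- set `U` has the empty pattern.
  refine ⟨fun j i => -rootSign U j * (2 * R * (2 * (j : ℝ) + 2) ^ (i : ℕ)),
    fun j => -rootSign U j * ((2 * (j : ℝ) + 2) ^ n - ∑ i : Fin n, R * (2 * (j : ℝ) + 2) ^ (i : ℕ)),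
    fun T => WithLp.toLp 2 fun i => ((rootPoly n T).coeff i / R + 1) / 2,
    fun T => {j | rootSign T j ≠ rootSign U j}, ?_, ?_, ?_, ?_, ?_⟩
  · intro j i
    exact mul_ne_zero (neg_ne_zero.2 (hU j)) (by positivity)
  · intro T T' h
    refine rootSign_injective fun j => ?_
    have hj := Finset.ext_iff.1 h j
    simp only [Finset.mem_filter, Finset.mem_univ, true_and] at hj
    rcases rootSign_eq_or T j with h1 | h1 <;> rcases rootSign_eq_or T' j with h2 | h2 <;>
      rcases rootSign_eq_or U j with h3 | h3 <;> rw [h1, h2, h3] at hj <;> rw [h1, h2] <;>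
      norm_num at hj
  · simp [U]
  · intro T i
    have h := abs_lt.1 (hR T i)
    have h1 : -1 < (rootPoly n T).coeff i / R := by rw [lt_div_iff₀ hR0]; linarith
    have h2 : (rootPoly n T).coeff i / R < 1 := by rw [div_lt_iff₀ hR0]; linarith
    constructor
    · simp only
      linarith
    · simp only
      linarith
  · intro T hT j
    have hval : ∑ i : Fin n, -rootSign U j * (2 * R * (2 * (j : ℝ) + 2) ^ (i : ℕ)) *
          (((rootPoly n T).coeff i / R + 1) / 2) +
        -rootSign U j * ((2 * (j : ℝ) + 2) ^ n - ∑ i : Fin n, R * (2 * (j : ℝ) + 2) ^ (i : ℕ)) =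
        -rootSign U j * (rootPoly n T).eval (2 * (j : ℝ) + 2) := by
      have hsum : ∑ i : Fin n, -rootSign U j * (2 * R * (2 * (j : ℝ) + 2) ^ (i : ℕ)) *
            (((rootPoly n T).coeff i / R + 1) / 2) =
          -rootSign U j * ∑ i : Fin n, (rootPoly n T).coeff i * (2 * (j : ℝ) + 2) ^ (i : ℕ) +
            -rootSign U j * ∑ i : Fin n, R * (2 * (j : ℝ) + 2) ^ (i : ℕ) := by
        rw [Finset.mul_sum, Finset.mul_sum, ← Finset.sum_add_distrib]
        refine Finset.sum_congr rfl fun i _ => ?_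
        clear_value R
        field_simp
        ring
      rw [rootPoly_eval hT, hsum]
      ring
    have hpos := rootSign_mul_rootPoly_pos n T j
    simp only [Finset.mem_filter, Finset.mem_univ, true_and, hval]
    rcases rootSign_eq_or T j with h1 | h1 <;> rcases rootSign_eq_or U j with h2 | h2 <;>
      rw [h1] at hpos <;> rw [h1, h2] <;> constructor <;> intro h <;>
      first | linarith | exact absurd rfl h | norm_num at h

/-! ### The last hidden layer. -/

/-- A layer of width `m` with generic output weights has one gradient for each set of at most `n`
of its neurons, and these have distinct norms. -/
theorem exists_lastLayer {n : ℕ} (m : ℕ) (hn : 1 ≤ n) :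
    ∃ (B : Euc n →ᵃ[ℝ] Euc m) (a : Fin m → ℝ)
      (v : {T : Finset (Fin m) // T.card ≤ n} → Euc n),
      (∀ T, HasPiece (fun x => ∑ j, a j * relu (B x) j) (v T)) ∧
      (n < m → ∀ T i, v T i ≠ 0) ∧ Function.Injective fun T => ‖v T‖ := by
  obtain ⟨b, c, y, S, hb, hS, hS0, hy, hsign⟩ := exists_arrangement n m
  let G : Finset (Fin m) → Fin n → MvPolynomial (Fin m) ℝ := fun s i =>
    ∑ j ∈ s, MvPolynomial.X j * MvPolynomial.C (b j i)
  have hG : ∀ a s i, MvPolynomial.eval a (G s i) = ∑ j ∈ s, a j * b j i := by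
    intro a s i
    simp [G]
  have hsingle : ∀ (l : Fin m) s i, ∑ j ∈ s, (Pi.single l 1 : Fin m → ℝ) j * b j i =
      if l ∈ s then b l i else 0 := by
    intro l s i
    simp [Pi.single_apply]
  -- The first family separates squared gradient norms, the second makes every gradient coordinate
  -- of a nonempty pattern nonzero.
  obtain ⟨a, -, ha⟩ := exists_forall_eval_ne_zero
    (Sum.elim
      (fun q : {q : Finset (Fin m) × Finset (Fin m) // q.1 ≠ q.2} =>
        ∑ i, G q.1.1 i ^ 2 - ∑ i, G q.1.2 i ^ 2)
      (fun q : {s : Finset (Fin m) // s.Nonempty} × Fin n => G q.1.1 q.2)) (by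
      rintro (⟨⟨s, s'⟩, hne⟩ | ⟨⟨s, l, hl⟩, i⟩)
      · obtain ⟨l, hl⟩ : ∃ l, ¬ (l ∈ s ↔ l ∈ s') := by
          by_contra! h
          exact hne (Finset.ext h)
        have hpos : 0 < ∑ i, b l i ^ 2 :=
          Finset.sum_pos (fun i _ => sq_pos_of_ne_zero (hb l i)) ⟨⟨0, hn⟩, Finset.mem_univ _⟩
        refine ⟨Pi.single l 1, ?_⟩
        simp only [Sum.elim_inl, map_sub, map_sum, map_pow, hG, hsingle]
        by_cases h1 : l ∈ s <;> by_cases h2 : l ∈ s' <;> simp [h1, h2, hpos.ne'] at hl ⊢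
      · refine ⟨Pi.single l 1, ?_⟩
        simp only [Sum.elim_inr, hG, hsingle]
        simpa [hl] using hb l i)
    (fun _ => univ) fun _ => infinite_univ
  refine ⟨affineOf b c, a, fun T => WithLp.toLp 2 fun i => ∑ j ∈ S T, a j * b j i, ?_, ?_, ?_⟩
  · rintro ⟨T, hT⟩
    refine ⟨y T, hy T, ∑ j ∈ S T, a j * c j, ?_⟩
    have hcont : ∀ j, ContinuousAt (fun x : Euc n => ∑ i, b j i * x i + c j) (y T) := by
      intro j
      fun_prop
    have h : ∀ᶠ x in 𝓝 (y T), ∀ j, max 0 (affineOf b c x j) =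
        if j ∈ S T then ∑ i, b j i * x i + c j else 0 := by
      refine eventually_all.2 fun j => ?_
      simp only [affineOf_apply]
      by_cases hj : j ∈ S T
      · filter_upwards [(hcont j).eventually (lt_mem_nhds ((hsign T hT j).1 hj))] with x hx
        rw [if_pos hj, max_eq_right hx.le]
      · filter_upwards [(hcont j).eventually (gt_mem_nhds ((hsign T hT j).2 hj))] with x hx
        rw [if_neg hj, max_eq_left hx.le]
    filter_upwards [h] with x hx
    simp only [relu, hx, mul_ite, mul_zero, Finset.sum_ite_mem, Finset.univ_inter, inner_eq_sum,
      Finset.sum_mul]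
    rw [Finset.sum_comm, ← Finset.sum_add_distrib]
    refine Finset.sum_congr rfl fun j _ => ?_
    rw [mul_add, Finset.mul_sum]
    simp only [mul_assoc]
  · rintro hnm ⟨T, hT⟩ i
    -- The empty pattern belongs only to the full set, which has `m > n` elements.
    have hne : (S T).Nonempty := by
      rw [Finset.nonempty_iff_ne_empty, ← hS0]
      intro h
      rw [hS h, Finset.card_univ, Fintype.card_fin] at hT
      omega
    have := ha (Sum.inr (⟨S T, hne⟩, i))
    simpa only [Sum.elim_inr, hG] using this
  · rintro ⟨T, hT⟩ ⟨T', hT'⟩ h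
    by_contra hne
    refine ha (Sum.inl ⟨(S T, S T'), fun h' => hne (Subtype.ext (hS h'))⟩) ?_
    have h := congrArg (· ^ 2) h
    simp only [EuclideanSpace.real_norm_sq_eq] at h
    simp only [Sum.elim_inl, map_sub, map_sum, map_pow, hG]
    exact sub_eq_zero.2 h

theorem card_finset_card_le (m n : ℕ) :
    Fintype.card {T : Finset (Fin m) // T.card ≤ n} = ∑ k ∈ Finset.range (n + 1), m.choose k := by
  rw [Fintype.card_subtype, Finset.card_eq_sum_card_fiberwise (f := Finset.card)
    (t := Finset.range (n + 1)) fun T hT => by simpa [Nat.lt_succ_iff] using hT]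
  refine Finset.sum_congr rfl fun k hk => ?_
  have h := Finset.card_powersetCard k (Finset.univ : Finset (Fin m))
  rw [Finset.card_fin] at h
  rw [← h]
  congr 1
  ext T
  simp only [Finset.mem_filter, Finset.mem_univ, true_and, Finset.mem_powersetCard,
    Finset.subset_univ, and_iff_right_iff_imp]
  have := Finset.mem_range.1 hk
  omega

/-! ### Stacking the layers. -/

theorem hiddenLayer_congr {w : ℕ → ℕ} {f g : ∀ l, Euc (w l) →ᵃ[ℝ] Euc (w (l + 1))} {l : ℕ}
    (h : ∀ k < l, f k = g k) : hiddenLayer w f l = hiddenLayer w g l := by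
  induction l with
  | zero => rfl
  | succ l ih =>
    funext x
    simp only [hiddenLayer]
    rw [h l l.lt_succ_self, ih fun k hk => h k (hk.trans l.lt_succ_self)]

/-- Stacking `l` folding layers before `F` multiplies the number of gradients of distinct norms by
the number of folds. -/
theorem exists_foldingLayers {w : ℕ → ℕ} (hn : 1 ≤ w 0) (l : ℕ)
    (hw : ∀ k, 1 ≤ k → k ≤ l → w 0 ≤ w k) {ι : Type} [Fintype ι] (F : Euc (w 0) → ℝ)
    (v : ι → Euc (w 0)) (hv : ∀ k, HasPiece F (v k)) (hv0 : 1 ≤ l → ∀ k i, v k i ≠ 0)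
    (hinj : Function.Injective fun k => ‖v k‖) :
    ∃ (f : ∀ l, Euc (w l) →ᵃ[ℝ] Euc (w (l + 1))) (r : Euc (w l) →ᵃ[ℝ] Euc (w 0))
      (κ : Type) (_ : Fintype κ) (v' : κ → Euc (w 0)),
      Fintype.card κ = (∏ k ∈ Finset.Ico 1 (l + 1), (w k / w 0) ^ w 0) * Fintype.card ι ∧
      (∀ k, HasPiece (fun x => F (r (hiddenLayer w f l x))) (v' k)) ∧
      Function.Injective fun k => ‖v' k‖ := by
  induction l generalizing ι F with
  | zero =>
    exact ⟨fun _ => AffineMap.const ℝ _ 0, AffineMap.id ℝ _, ι, inferInstance, v, by simp,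
      hv, hinj⟩
  | succ l ih =>
    -- The fold nearest to `F` is absorbed into `F`, and the induction hypothesis supplies the
    -- layers below it.
    obtain ⟨B, A, v₁, hv₁, hv₁0, hinj₁⟩ := exists_fold (m := w (l + 1)) hn
      (hw (l + 1) (by omega) le_rfl) F v hv (hv0 (by omega)) hinj
    obtain ⟨f, r, κ, hκ, v', hcard, hv', hinj'⟩ := ih (fun k h1 h2 => hw k h1 (by omega))
      (fun x => F (A (relu (B x)))) v₁ hv₁ (fun _ => hv₁0) hinj₁
    -- The affine read-out `r` of the lower layers merges with `B` into a single affine map, so no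
    -- extra layer is spent.
    refine ⟨Function.update f l (B.comp r), A, κ, hκ, v', ?_, ?_, hinj'⟩
    · rw [hcard, Finset.prod_Ico_succ_top (by omega : 1 ≤ l + 1)]
      simp only [Fintype.card_prod, Fintype.card_fun, Fintype.card_fin]
      ring
    · have h : hiddenLayer w (Function.update f l (B.comp r)) l = hiddenLayer w f l :=
        hiddenLayer_congr fun k hk => Function.update_of_ne hk.ne _ _
      simpa [hiddenLayer, h] using hv'

end ReLUComplexity

open ReLUComplexity in
theorem mainTheorem3 (L : ℕ) (w : ℕ → ℕ) (hL : 1 ≤ L) (hn : 1 ≤ w 0)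
    (hw : ∀ l, 1 ≤ l → l ≤ L → w 0 ≤ w l) (hlast : 2 ≤ L → w 0 < w L)
    (hout : 1 ≤ w (L + 1)) :
    (((∏ l ∈ Finset.Ico 1 L, (w l / w 0) ^ w 0) *
        ∑ k ∈ Finset.range (w 0 + 1), (w L).choose k : ℕ) : ℕ∞) ≤
      ReLUComplexity.classComplexity
        (ReLUComplexity.fullNetworks w L (ReLUComplexity.unitCube (w 0))) := by
  obtain ⟨l, rfl⟩ : ∃ l, L = l + 1 := ⟨L - 1, by omega⟩
  obtain ⟨B, a, v, hv, hv0, hinj⟩ := exists_lastLayer (w (l + 1)) hn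
  obtain ⟨f, r, κ, hκ, v', hcard, hv', hinj'⟩ := exists_foldingLayers hn l
    (fun k h1 h2 => hw k h1 (by omega)) _ v hv (fun h => hv0 (hlast (by omega))) hinj
  -- The output map repeats the same scalar combination in every coordinate.
  let f' := Function.update (Function.update f l (B.comp r)) (l + 1) (affineOf (fun _ => a) 0)
  have hf' : hiddenLayer w f' l = hiddenLayer w f l := hiddenLayer_congr fun k hk => by
    simp only [f']
    rw [Function.update_of_ne (by omega), Function.update_of_ne (by omega)]
  have hl : f' l = B.comp r := by
    simp only [f']
    rw [Function.update_of_ne (by omega), Function.update_self]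
  have hl1 : f' (l + 1) = affineOf (fun _ => a) 0 := Function.update_self _ _ _
  have hcomp := card_le_complexity hout _
    (fun x : unitCube (w 0) => network w (l + 1) f' (x : Euc (w 0)))
    (fun x => by
      ext i
      simp only [network, hl1, hiddenLayer, hl, hf']
      rw [affineOf_apply, Pi.zero_apply, add_zero]
      rfl) v' hv' hinj'
  rw [← card_finset_card_le, ← hcard]
  exact hcomp.trans (le_iSup₂ (f := fun F _ => complexity F) _ ⟨f', rfl⟩)
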